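/- All groups are finite and $p$ is a prime. A Camina $p$-group is a $p$-group $G$ such that for every $g\in G\setminus G'$ the conjugacy class of $g$ is the coset $gG'$. Let $G$ be a Camina $p$-group of nilpotence class $3$, and put $G_3=[G',G]$. For $a\in G\setminus G'$ let $A(a)=\{x\in G : [a,x]\in G_3\}$, i.e. $A(a)/G_3=C_{G/G_3}(aG_3)$, and set $\mathcal A(G)=\{A(a) : a\in G\setminus G'\}$ and $\mathcal A^*(G)=\{A\in\mathcal A(G) : A/G_3 \text{ is abelian}\}$. For $N\le G_3$ with $|G_3:N|=p$ let $C(N)$ be the subgroup containing $N$ with $C(N)/N=C_{G/N}(G'/N)$, and set $\mathcal C(G)=\{C(N) : N\le G_3,\ |G_3:N|=p\}$. If $A\in\mathcal A^*(G)\setminus\mathcal C(G)$, then $A$ is semi-extraspecial, i.e. $A$ is a nontrivial $p$-group such that for every subgroup $N$ of index $p$ in $Z(A)$ the quotient $E=A/N$ is extraspecial, meaning that $E$ is a $p$-group, $Z(E)=E'=\Phi(E)$ (the Frattini subgroup) and $|Z(E)|=p$. -/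

import Mathlib

open scoped Pointwise commutatorElement

namespace CaminaGroup

/-- `G` is a Camina group: for every `g ∈ G \ G'` the conjugacy class of `g` is the coset `gG'`. -/
def IsCamina (G : Type*) [Group G] : Prop :=
  ∀ g : G, g ∉ commutator G → conjugatesOf g = g • (commutator G : Set G)

/-- `G₃ = [G', G]`. -/
def third (G : Type*) [Group G] : Subgroup G :=
  ⁅commutator G, (⊤ : Subgroup G)⁆

instance third_normal (G : Type*) [Group G] : (third G).Normal := by
  unfold third
  infer_instance

/-- `A(a)`, the subgroup with `A(a)/G₃ = C_{G/G₃}(aG₃)`. -/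
def centA {G : Type*} [Group G] (a : G) : Subgroup G :=
  (Subgroup.centralizer {(QuotientGroup.mk' (third G)) a}).comap (QuotientGroup.mk' (third G))

/-- `A(a) = {x ∈ G | [a, x] ∈ G₃}`. -/
theorem mem_centA_iff {G : Type*} [Group G] (a x : G) : x ∈ centA a ↔ ⁅a, x⁆ ∈ third G := by
  have h : ⁅a, x⁆ ∈ third G ↔ (QuotientGroup.mk' (third G)) ⁅a, x⁆ = 1 :=
    (QuotientGroup.eq_one_iff _).symm
  rw [h, map_commutatorElement, commutatorElement_eq_one_iff_mul_comm]
  unfold centA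
  rw [Subgroup.mem_comap, Subgroup.mem_centralizer_singleton_iff]
  exact eq_comm

/-- `𝒜(G) = {A(a) | a ∈ G \ G'}`. -/
def setA (G : Type*) [Group G] : Set (Subgroup G) :=
  {A | ∃ a : G, a ∉ commutator G ∧ A = centA a}

/-- `𝒜*(G)`: the members `A` of `𝒜(G)` such that `A/G₃` is abelian
(`A/G₃` is the image of `A` in `G/G₃`; every `A ∈ 𝒜(G)` contains `G₃`). -/
def setAStar (G : Type*) [Group G] : Set (Subgroup G) :=
  {A | A ∈ setA G ∧ IsMulCommutative (A.map (QuotientGroup.mk' (third G)))}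

/-- `C(N)`, the subgroup with `C(N)/N = C_{G/N}(G'/N)`. -/
def centC {G : Type*} [Group G] (N : Subgroup G) [N.Normal] : Subgroup G :=
  (Subgroup.centralizer ((commutator G).map (QuotientGroup.mk' N) : Set (G ⧸ N))).comap
    (QuotientGroup.mk' N)

/-- `𝒞(G) = {C(N) | N ≤ G₃, |G₃ : N| = p}`. When `G` has class at most three, `G₃` is central,
so each such `N` is automatically normal. -/
def setC (p : ℕ) (G : Type*) [Group G] : Set (Subgroup G) :=
  {C | ∃ (N : Subgroup G) (_ : N.Normal), N ≤ third G ∧ N.relIndex (third G) = p ∧ C = centC N}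

/-- An extraspecial `p`-group: `Z(E) = E' = Φ(E)` has order `p`. -/
structure IsExtraspecial (p : ℕ) (E : Type*) [Group E] : Prop where
  isPGroup : IsPGroup p E
  card_center : Nat.card (Subgroup.center E) = p
  commutator_eq : commutator E = Subgroup.center E
  frattini_eq : frattini E = Subgroup.center E

/-- A semi-extraspecial `p`-group: a nontrivial `p`-group `H` such that `H/N` is extraspecial for
every `N ≤ Z(H)` with `|Z(H) : N| = p` (such an `N` is automatically normal in `H`). -/
structure IsSemiExtraspecial (p : ℕ) (H : Type*) [Group H] : Prop where
  isPGroup : IsPGroup p H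
  nontrivial : Nontrivial H
  quotient : ∀ (N : Subgroup H) [N.Normal], N ≤ Subgroup.center H →
    N.relIndex (Subgroup.center H) = p → IsExtraspecial p (H ⧸ N)

end CaminaGroup

/-!
Write `V = G/G'` and `W = G'/G₃`. Commutators induce an alternating map `β : V × V → W` of
`𝔽_p`-vector spaces, and `G` being a Camina group means that `β(v, ·)` is onto for all `v ≠ 0`.
Hence the form `λ ∘ β` is nondegenerate for every nonzero functional `λ` on `W`, so its Pfaffian, a
form of degree `½ dim V` in the `dim W` coordinates of `λ`, has only the trivial zero, and
Chevalley–Warning gives `2 dim W ≤ dim V`.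

For `N` of index `p` in `G₃`, commutators also induce `τ : W × V → G₃/N ≅ 𝔽_p`, whose kernel in `V`
is `C(N)/G'`. The three subgroups lemma gives `τ(β(c, d), ·) = 0` for `c, d ∈ C(N)/G'`. Counting
dimensions, `dim V = 2 dim W`, `dim C(N)/G' = dim W` and `τ` is injective on `W`. If
`A = A(a) ≠ C(N)` and `A/G₃` is abelian, then `A/G'` and `C(N)/G'` are complements in `V`. So
commutators of `A` modulo `N` induce a nondegenerate form on `A/G₃`, that is, `Z(A/N) = G₃/N`, and
`A/N` is extraspecial.
-/

namespace CaminaGroup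

open Matrix Module

section AlternatingMatrices

variable {R S ι κ σ : Type*} [CommRing R] [CommRing S]

/-- An alternating matrix, i.e. the Gram matrix of an alternating bilinear form; in characteristic
two this is stronger than being skew-symmetric. -/
structure IsAlternating (M : Matrix ι ι R) : Prop where
  transpose_eq_neg : Mᵀ = -M
  apply_self (i : ι) : M i i = 0

namespace IsAlternating

theorem apply_swap {M : Matrix ι ι R} (hM : IsAlternating M) (i j : ι) : M j i = -M i j :=
  congrFun (congrFun hM.transpose_eq_neg i) j

theorem add {M N : Matrix ι ι R} (hM : IsAlternating M) (hN : IsAlternating N) :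
    IsAlternating (M + N) where
  transpose_eq_neg := by
    rw [transpose_add, hM.transpose_eq_neg, hN.transpose_eq_neg, neg_add]
  apply_self i := by rw [Matrix.add_apply, hM.apply_self, hN.apply_self, add_zero]

theorem sum_smul {s : Finset σ} {M : σ → Matrix ι ι R} (hM : ∀ k, IsAlternating (M k))
    (c : σ → R) : IsAlternating (∑ k ∈ s, c k • M k) where
  transpose_eq_neg := by
    simp only [transpose_sum, transpose_smul, (hM _).transpose_eq_neg, smul_neg,
      Finset.sum_neg_distrib]
  apply_self i := by
    simp only [Matrix.sum_apply, Matrix.smul_apply, (hM _).apply_self, smul_zero,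
      Finset.sum_const_zero]

theorem map {M : Matrix ι ι R} (hM : IsAlternating M) (f : R →+* S) : IsAlternating (M.map f) where
  transpose_eq_neg := by
    ext i j
    rw [transpose_apply, map_apply, hM.apply_swap, map_neg, neg_apply, map_apply]
  apply_self i := by rw [map_apply, hM.apply_self, map_zero]

theorem submatrix {M : Matrix ι ι R} (hM : IsAlternating M) (f : κ → ι) :
    IsAlternating (M.submatrix f f) where
  transpose_eq_neg := by rw [transpose_submatrix, hM.transpose_eq_neg]; rfl
  apply_self i := hM.apply_self (f i)

variable [Fintype ι]

theorem dotProduct_mulVec_self {M : Matrix ι ι R} (hM : IsAlternating M) (v : ι → R) :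
    v ⬝ᵥ M *ᵥ v = 0 := by
  simp only [dotProduct, mulVec, Finset.mul_sum]
  rw [← Fintype.sum_prod_type']
  refine Finset.sum_involution (fun ij _ => ij.swap) (fun ij _ => ?_) (fun ij _ hne hij => hne ?_)
    (fun _ _ => Finset.mem_univ _) (fun ij _ => ij.swap_swap)
  · rw [Prod.fst_swap, Prod.snd_swap, hM.apply_swap ij.1 ij.2]
    ring
  · rw [show ij.2 = ij.1 from congrArg Prod.fst hij, hM.apply_self, zero_mul, mul_zero]

theorem transpose_mul_mul {M : Matrix ι ι R} (hM : IsAlternating M) (B : Matrix ι κ R) :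
    IsAlternating (Bᵀ * M * B) where
  transpose_eq_neg := by
    rw [transpose_mul, transpose_mul, transpose_transpose, hM.transpose_eq_neg, Matrix.neg_mul,
      Matrix.mul_neg, Matrix.mul_assoc]
  apply_self i := by
    rw [Matrix.mul_assoc]
    exact hM.dotProduct_mulVec_self fun j => B j i

theorem neg {ι : Type*} {M : Matrix ι ι R} (hM : IsAlternating M) : IsAlternating (-M) where
  transpose_eq_neg := by rw [transpose_neg, hM.transpose_eq_neg]
  apply_self i := by rw [neg_apply, hM.apply_self, neg_zero]

variable [DecidableEq ι]

theorem inv {M : Matrix ι ι R} (hM : IsAlternating M) (hdet : IsUnit M.det) :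
    IsAlternating M⁻¹ := by
  have hneg : -(M⁻¹)ᵀ = M⁻¹ := by
    rw [transpose_nonsing_inv, hM.transpose_eq_neg]
    exact neg_eq_iff_eq_neg.mpr (inv_eq_left_inv (by rw [neg_mul_neg, nonsing_inv_mul M hdet]))
  have hcongr : M⁻¹ = (M⁻¹)ᵀ * -M * M⁻¹ := by
    rw [Matrix.mul_neg, ← Matrix.neg_mul, hneg, nonsing_inv_mul M hdet, Matrix.one_mul]
  rw [hcongr]
  exact hM.neg.transpose_mul_mul _

theorem det_eq_sq_of_card_eq_two {M : Matrix ι ι R} (hM : IsAlternating M)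
    (hι : Fintype.card ι = 2) {i j : ι} (hij : i ≠ j) : M.det = M i j ^ 2 := by
  have hinj : Function.Injective ![i, j] := by
    intro k l
    fin_cases k <;> fin_cases l <;> simp [hij, hij.symm]
  let e : Fin 2 ≃ ι := .ofBijective ![i, j]
    ((Fintype.bijective_iff_injective_and_card _).mpr ⟨hinj, by rw [hι, Fintype.card_fin]⟩)
  rw [← det_submatrix_equiv_self e M, det_fin_two]
  change M i i * M j j - M i j * M j i = _
  rw [hM.apply_self, hM.apply_swap i j]
  ring

theorem det_eq_det_mul_det_schur {M : Matrix ι ι R} (hM : IsAlternating M) (p : ι → Prop)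
    [DecidablePred p] (hP : IsUnit (M.toBlock p p).det) :
    ∃ N : Matrix {i // ¬p i} {i // ¬p i} R,
      IsAlternating N ∧ M.det = (M.toBlock p p).det * N.det := by
  set P := M.toBlock p p
  set B := M.toBlock p fun i => ¬p i
  set D := M.toBlock (fun i => ¬p i) fun i => ¬p i
  have hC : M.toBlock (fun i => ¬p i) p = -Bᵀ := by
    ext i j
    exact hM.apply_swap _ _
  have := invertibleOfIsUnitDet P hP
  refine ⟨D + Bᵀ * P⁻¹ * B, ?_, ?_⟩
  · exact (hM.submatrix _).add (((hM.submatrix _).inv hP).transpose_mul_mul B)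
  · rw [det_toBlock M p, hC, det_fromBlocks₁₁, invOf_eq_nonsing_inv, Matrix.neg_mul,
      Matrix.neg_mul, sub_neg_eq_add]

theorem isSquare_det {K ι : Type*} [Field K] [Fintype ι] [DecidableEq ι] {M : Matrix ι ι K}
    (hM : IsAlternating M) : IsSquare M.det := by
  induction hn : Fintype.card ι using Nat.strong_induction_on generalizing ι with
  | _ n ih =>
    rcases eq_or_ne M 0 with rfl | hne
    · cases isEmpty_or_nonempty ι
      · exact det_isEmpty (A := (0 : Matrix ι ι K)) ▸ IsSquare.one
      · exact det_zero (n := ι) (R := K) ▸ IsSquare.zero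
    obtain ⟨i, j, hij⟩ : ∃ i j, M i j ≠ 0 := by
      by_contra! h
      exact hne (Matrix.ext h)
    have hne_ij : i ≠ j := by
      rintro rfl
      exact hij (hM.apply_self i)
    have hP : (M.toBlock (fun k => k = i ∨ k = j) fun k => k = i ∨ k = j).det = M i j ^ 2 :=
      (hM.submatrix Subtype.val).det_eq_sq_of_card_eq_two
        (Fintype.card_subtype_eq_or_eq_of_ne hne_ij)
        (i := ⟨i, .inl rfl⟩) (j := ⟨j, .inr rfl⟩) (by simpa using hne_ij)
    obtain ⟨N, hN, hdet⟩ := hM.det_eq_det_mul_det_schur (fun k => k = i ∨ k = j)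
      (hP ▸ (pow_ne_zero 2 hij).isUnit)
    rw [hdet, hP]
    exact (IsSquare.sq _).mul
      (ih _ (hn ▸ Fintype.card_subtype_lt (x := i) (not_not.mpr (.inl rfl))) hN rfl)

theorem isSquare_det_of_isIntegrallyClosed [IsDomain R] [IsIntegrallyClosed R] {M : Matrix ι ι R}
    (hM : IsAlternating M) : IsSquare M.det := by
  obtain ⟨r, hr⟩ := (hM.map (algebraMap R (FractionRing R))).isSquare_det
  rw [← RingHom.mapMatrix_apply, ← RingHom.map_det] at hr
  obtain ⟨s, rfl⟩ := IsIntegrallyClosed.exists_algebraMap_eq_of_isIntegral_pow (R := R) (x := r)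
    two_pos (by rw [pow_two, ← hr]; exact isIntegral_algebraMap)
  exact ⟨s, IsFractionRing.injective R (FractionRing R) (hr.trans (map_mul _ s s).symm)⟩

end IsAlternating

end AlternatingMatrices

section ChevalleyWarning

variable {R K ι σ : Type*} [CommRing R] [Field K] [Fintype ι] [DecidableEq ι]

theorem totalDegree_det_le {d : ℕ} {M : Matrix ι ι (MvPolynomial σ R)}
    (hM : ∀ i j, (M i j).totalDegree ≤ d) : M.det.totalDegree ≤ Fintype.card ι * d := by
  rw [det_apply]
  refine MvPolynomial.totalDegree_finsetSum_le fun π _ => ?_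
  have hprod : (∏ i, M (π i) i).totalDegree ≤ Fintype.card ι * d :=
    (MvPolynomial.totalDegree_finsetProd _ _).trans
      (Finset.sum_le_card_nsmul _ _ _ fun i _ => hM (π i) i)
  rcases Int.units_eq_one_or (Equiv.Perm.sign π) with hπ | hπ
  · rwa [hπ, one_smul]
  · rwa [hπ, Units.neg_smul, one_smul, MvPolynomial.totalDegree_neg]

variable [Fintype σ]

/-- The polynomial is the Pfaffian of the generic member of the linear system, up to sign. -/
theorem exists_eval_sq_eq_det_sum_smul {M : σ → Matrix ι ι K} (hM : ∀ s, IsAlternating (M s)) :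
    ∃ r : MvPolynomial σ K, 2 * r.totalDegree ≤ Fintype.card ι ∧
      ∀ c : σ → K, MvPolynomial.eval c r ^ 2 = (∑ s, c s • M s).det := by
  let X : Matrix ι ι (MvPolynomial σ K) :=
    ∑ s, (MvPolynomial.X s : MvPolynomial σ K) • (M s).map MvPolynomial.C
  have hX : ∀ i j, X i j = ∑ s, MvPolynomial.X s * MvPolynomial.C (M s i j) := fun i j => by
    simp only [X, Matrix.sum_apply, Matrix.smul_apply, map_apply, smul_eq_mul]
  have hdeg : X.det.totalDegree ≤ Fintype.card ι * 1 := by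
    refine totalDegree_det_le fun i j => ?_
    rw [hX]
    refine MvPolynomial.totalDegree_finsetSum_le fun s _ => ?_
    refine (MvPolynomial.totalDegree_mul _ _).trans ?_
    rw [MvPolynomial.totalDegree_X, MvPolynomial.totalDegree_C]
  obtain ⟨r, hr⟩ := (IsAlternating.sum_smul (s := Finset.univ) (fun s => (hM s).map _)
    MvPolynomial.X : IsAlternating X).isSquare_det_of_isIntegrallyClosed
  refine ⟨r, ?_, fun c => ?_⟩
  · rcases eq_or_ne r 0 with rfl | h0
    · simp only [MvPolynomial.totalDegree_zero, mul_zero, zero_le]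
    · rw [hr, MvPolynomial.totalDegree_mul_of_isDomain h0 h0] at hdeg
      lia
  · have heval : (MvPolynomial.eval c).mapMatrix X = ∑ s, c s • M s := by
      ext i j
      simp only [RingHom.mapMatrix_apply, map_apply, hX, map_sum, map_mul, MvPolynomial.eval_X,
        MvPolynomial.eval_C, Matrix.sum_apply, Matrix.smul_apply, smul_eq_mul]
    rw [sq, ← map_mul, ← hr, RingHom.map_det, heval]

theorem two_mul_card_le_of_det_sum_smul_ne_zero [Finite K] [Nonempty ι] {M : σ → Matrix ι ι K}
    (hM : ∀ s, IsAlternating (M s)) (hdet : ∀ c : σ → K, c ≠ 0 → (∑ s, c s • M s).det ≠ 0) :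
    2 * Fintype.card σ ≤ Fintype.card ι := by
  classical
  have := Fintype.ofFinite K
  obtain ⟨r, hdeg, hr⟩ := exists_eval_sq_eq_det_sum_smul hM
  have hzero : ∀ c : σ → K, MvPolynomial.eval c r = 0 ↔ c = 0 := by
    intro c
    rw [← sq_eq_zero_iff, hr]
    refine ⟨fun h => by_contra fun hc => hdet c hc h, ?_⟩
    rintro rfl
    simp only [Pi.zero_apply, zero_smul, Finset.sum_const_zero, det_zero]
  by_contra! hlt
  have hdvd := char_dvd_card_solutions (ringChar K) (f := r) (by lia)
  simp only [hzero, Fintype.card_unique] at hdvd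
  exact CharP.ringChar_ne_one (Nat.dvd_one.mp hdvd)

end ChevalleyWarning

section LinearAlgebra

variable {K V W : Type*} [Field K] [AddCommGroup V] [Module K V] [AddCommGroup W] [Module K W]

theorem IsAlternating.toMatrix₂ {ι : Type*} [Fintype ι] [DecidableEq ι] {β : V →ₗ[K] V →ₗ[K] K}
    (hβ : β.IsAlt) (b : Basis ι K V) : IsAlternating (LinearMap.toMatrix₂ b b β) where
  transpose_eq_neg := by
    ext i j
    rw [transpose_apply, Matrix.neg_apply, LinearMap.toMatrix₂_apply, LinearMap.toMatrix₂_apply,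
      hβ.neg]
  apply_self i := (LinearMap.toMatrix₂_apply b b β i i).trans (hβ (b i))

theorem separatingLeft_compr₂ {β : V →ₗ[K] V →ₗ[K] W}
    (hsurj : ∀ a, a ≠ 0 → Function.Surjective (β a)) {l : W →ₗ[K] K} (hl : l ≠ 0) :
    (β.compr₂ l).SeparatingLeft := by
  refine fun a ha => by_contra fun h0 => hl (LinearMap.ext fun w => ?_)
  obtain ⟨x, rfl⟩ := hsurj a h0 w
  exact ha x

variable [FiniteDimensional K V]

theorem two_mul_finrank_le_of_isotropic {β : V →ₗ[K] V →ₗ[K] K} (hβ : β.SeparatingLeft)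
    {C : Submodule K V} (hC : ∀ c ∈ C, ∀ d ∈ C, β c d = 0) : 2 * finrank K C ≤ finrank K V := by
  have hinj : Function.Injective β :=
    LinearMap.ker_eq_bot.mp (LinearMap.separatingLeft_iff_ker_eq_bot.mp hβ)
  have hmap : C.map β ≤ C.dualAnnihilator := by
    rintro _ ⟨c, hc, rfl⟩
    exact (Submodule.mem_dualAnnihilator _).mpr (hC c hc)
  have hle : finrank K C ≤ finrank K C.dualAnnihilator :=
    (C.equivMapOfInjective β hinj).finrank_eq.trans_le (Submodule.finrank_mono hmap)
  have := Subspace.finrank_add_finrank_dualAnnihilator_eq C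
  lia

theorem finrank_ker_add_finrank_of_surjective {f : V →ₗ[K] W} (hf : Function.Surjective f) :
    finrank K (LinearMap.ker f) + finrank K W = finrank K V := by
  rw [← f.finrank_range_add_finrank_ker, f.range_eq_top.mpr hf, finrank_top, add_comm]

variable [FiniteDimensional K W]

theorem finrank_add_finrank_ker_le (τ : W →ₗ[K] V →ₗ[K] K) :
    finrank K V + finrank K (LinearMap.ker τ) ≤ finrank K (LinearMap.ker τ.flip) + finrank K W := by
  have hrange : LinearMap.range τ.flip ≤ (LinearMap.ker τ).dualAnnihilator := by
    rintro _ ⟨v, rfl⟩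
    exact (Submodule.mem_dualAnnihilator _).mpr fun w hw => LinearMap.congr_fun hw v
  have := Submodule.finrank_mono hrange
  have := LinearMap.finrank_range_add_finrank_ker τ.flip
  have := Subspace.finrank_add_finrank_dualAnnihilator_eq (LinearMap.ker τ)
  lia

variable [Finite K] {β : V →ₗ[K] V →ₗ[K] W} {τ : W →ₗ[K] V →ₗ[K] K}

theorem two_mul_finrank_le_of_isAlt [Nontrivial V] (hβ : β.IsAlt)
    (hsurj : ∀ a, a ≠ 0 → Function.Surjective (β a)) : 2 * finrank K W ≤ finrank K V := by
  let b := finBasis K V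
  let c := finBasis K W
  have : Nonempty (Fin (finrank K V)) := ⟨⟨0, finrank_pos⟩⟩
  have hM : ∀ s, IsAlternating (LinearMap.toMatrix₂ b b (β.compr₂ (c.coord s))) := fun s =>
    .toMatrix₂ (fun v => by rw [LinearMap.compr₂_apply, hβ v, map_zero]) b
  have hdet : ∀ x : Fin (finrank K W) → K, x ≠ 0 →
      (∑ s, x s • LinearMap.toMatrix₂ b b (β.compr₂ (c.coord s))).det ≠ 0 := by
    intro x hx
    have hl : ∑ s, x s • c.coord s ≠ 0 := fun h =>
      hx (funext (Fintype.linearIndependent_iff.mp c.dualBasis.linearIndependent x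
        (by simpa only [Basis.coe_dualBasis] using h)))
    have hsum : ∑ s, x s • LinearMap.toMatrix₂ b b (β.compr₂ (c.coord s)) =
        LinearMap.toMatrix₂ b b (β.compr₂ (∑ s, x s • c.coord s)) := by
      ext i j
      simp only [Matrix.sum_apply, Matrix.smul_apply, LinearMap.toMatrix₂_apply,
        LinearMap.compr₂_apply, LinearMap.sum_apply, LinearMap.smul_apply]
    rw [hsum, ← LinearMap.separatingLeft_iff_det_ne_zero]
    exact separatingLeft_compr₂ hsurj hl
  simpa only [Fintype.card_fin] using two_mul_card_le_of_det_sum_smul_ne_zero hM hdet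

theorem finrank_eq_and_ker_eq_bot (hβ : β.IsAlt)
    (hsurj : ∀ a, a ≠ 0 → Function.Surjective (β a)) (hτ : τ ≠ 0)
    (hC : ∀ c ∈ LinearMap.ker τ.flip, ∀ d ∈ LinearMap.ker τ.flip, τ (β c d) = 0) :
    finrank K V = 2 * finrank K W ∧ finrank K (LinearMap.ker τ.flip) = finrank K W ∧
      LinearMap.ker τ = ⊥ := by
  obtain ⟨v, hv⟩ : ∃ v, τ.flip v ≠ 0 := by
    by_contra! h
    exact hτ (LinearMap.ext fun w => LinearMap.ext fun v => LinearMap.congr_fun (h v) w)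
  have : Nontrivial V := nontrivial_of_ne v 0 fun h => hv (by rw [h, map_zero])
  have hW : 2 * finrank K W ≤ finrank K V := two_mul_finrank_le_of_isAlt hβ hsurj
  have hker : 2 * finrank K (LinearMap.ker τ.flip) ≤ finrank K V :=
    two_mul_finrank_le_of_isotropic (separatingLeft_compr₂ hsurj hv) fun c hc d hd =>
      LinearMap.congr_fun (hC c hc d hd) v
  have := finrank_add_finrank_ker_le τ
  exact ⟨by lia, by lia, Submodule.finrank_eq_zero.mp (by lia)⟩

theorem disjoint_ker_ker_flip (hβ : β.IsAlt)
    (hsurj : ∀ a, a ≠ 0 → Function.Surjective (β a)) (hτ : τ ≠ 0)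
    (hC : ∀ c ∈ LinearMap.ker τ.flip, ∀ d ∈ LinearMap.ker τ.flip, τ (β c d) = 0)
    {a : V} (ha : a ≠ 0) (hU : ∀ x ∈ LinearMap.ker (β a), ∀ y ∈ LinearMap.ker (β a), β x y = 0)
    (hne : LinearMap.ker (β a) ≠ LinearMap.ker τ.flip) :
    Disjoint (LinearMap.ker (β a)) (LinearMap.ker τ.flip) := by
  obtain ⟨hV, hflip, hτ_inj⟩ := finrank_eq_and_ker_eq_bot hβ hsurj hτ hC
  have hker : ∀ u, u ≠ 0 → finrank K (LinearMap.ker (β u)) = finrank K W := fun u hu => by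
    have := finrank_ker_add_finrank_of_surjective (hsurj u hu)
    lia
  rw [Submodule.disjoint_def]
  refine fun u hu hu' => by_contra fun h0 => hne ?_
  calc LinearMap.ker (β a) = LinearMap.ker (β u) :=
        Submodule.eq_of_le_of_finrank_eq (hU u hu) (by rw [hker a ha, hker u h0])
    _ = LinearMap.ker τ.flip := by
        refine (Submodule.eq_of_le_of_finrank_eq (fun y hy => ?_) (by rw [hflip, hker u h0])).symm
        exact LinearMap.ker_eq_bot'.mp hτ_inj _ (hC u hu' y hy)

theorem eq_zero_of_forall_mem_ker (hβ : β.IsAlt)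
    (hsurj : ∀ a, a ≠ 0 → Function.Surjective (β a)) (hτ : τ ≠ 0)
    (hC : ∀ c ∈ LinearMap.ker τ.flip, ∀ d ∈ LinearMap.ker τ.flip, τ (β c d) = 0)
    {a : V} (ha : a ≠ 0) (hdis : Disjoint (LinearMap.ker (β a)) (LinearMap.ker τ.flip))
    {w : W} (hw : ∀ u ∈ LinearMap.ker (β a), τ w u = 0) : w = 0 := by
  obtain ⟨hV, hflip, hτ_inj⟩ := finrank_eq_and_ker_eq_bot hβ hsurj hτ hC
  have hsup : LinearMap.ker (β a) ⊔ LinearMap.ker τ.flip = ⊤ := by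
    refine Submodule.eq_top_of_disjoint _ _ ?_ hdis
    have := finrank_ker_add_finrank_of_surjective (hsurj a ha)
    lia
  have hflip_le : LinearMap.ker τ.flip ≤ LinearMap.ker (τ w) := fun c hc => LinearMap.congr_fun hc w
  have hker : LinearMap.ker (τ w) = ⊤ := top_le_iff.mp (hsup ▸ sup_le hw hflip_le)
  exact LinearMap.ker_eq_bot'.mp hτ_inj w (LinearMap.ker_eq_top.mp hker)

end LinearAlgebra

section Bimultiplicative

/-- A bimultiplicative map between groups of exponent `p`, read additively as a `ZMod p`-bilinear
map. The codomain is written `Multiplicative A` so that both `A = ZMod p` and `A = Additive R` are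
covered. -/
def toZModBilinear (p : ℕ) {P Q A : Type*} [CommGroup P] [CommGroup Q] [AddCommGroup A]
    [Module (ZMod p) (Additive P)] [Module (ZMod p) (Additive Q)] [Module (ZMod p) A]
    (B : P →* Q →* Multiplicative A) : Additive P →ₗ[ZMod p] Additive Q →ₗ[ZMod p] A :=
  AddMonoidHom.toZModLinearMap p <|
    AddMonoidHom.mk' (fun x => (MonoidHom.toAdditiveLeft (B x.toMul)).toZModLinearMap p)
      fun x y => by ext z; exact congrArg (fun f => (f z.toMul).toAdd) (map_mul B x.toMul y.toMul)

variable {p : ℕ} [Fact p.Prime] {P Q : Type*} [CommGroup P] [CommGroup Q] [Finite P] [Finite Q]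
  {B : P →* P →* Q} {T : Q →* P →* Multiplicative (ZMod p)}

theorem disjoint_ker_and_eq_one_of_bimultiplicative (hP : ∀ x : P, x ^ p = 1)
    (hQ : ∀ q : Q, q ^ p = 1) (hB : ∀ x, B x x = 1)
    (hsurj : ∀ a, a ≠ 1 → Function.Surjective (B a)) (hT : T ≠ 1)
    (hC : ∀ c ∈ T.flip.ker, ∀ d ∈ T.flip.ker, T (B c d) = 1) {a : P} (ha : a ≠ 1)
    (hU : ∀ x ∈ (B a).ker, ∀ y ∈ (B a).ker, B x y = 1) (hne : (B a).ker ≠ T.flip.ker) :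
    Disjoint (B a).ker T.flip.ker ∧ ∀ w, (∀ u ∈ (B a).ker, T w u = 1) → w = 1 := by
  let := AddCommGroup.zmodModule (n := p) (G := Additive P) hP
  let := AddCommGroup.zmodModule (n := p) (G := Additive Q) hQ
  have : Module.Finite (ZMod p) (Additive P) := .of_finite
  have : Module.Finite (ZMod p) (Additive Q) := .of_finite
  let β : Additive P →ₗ[ZMod p] Additive P →ₗ[ZMod p] Additive Q :=
    toZModBilinear p (A := Additive Q) B
  let τ : Additive Q →ₗ[ZMod p] Additive P →ₗ[ZMod p] ZMod p := toZModBilinear p T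
  have hβ : β.IsAlt := hB
  have hβ_surj : ∀ v : Additive P, v ≠ 0 → Function.Surjective (β v) := hsurj
  have hker_flip : ∀ c, c ∈ LinearMap.ker τ.flip ↔ c.toMul ∈ T.flip.ker := fun c =>
    ⟨fun h => MonoidHom.ext fun w => LinearMap.congr_fun h (.ofMul w),
      fun h => LinearMap.ext fun w => DFunLike.congr_fun h w.toMul⟩
  have hτ : τ ≠ 0 := fun h => hT (MonoidHom.ext fun w => MonoidHom.ext fun v =>
    LinearMap.congr_fun (LinearMap.congr_fun h (.ofMul w)) (.ofMul v))
  have hβ_flip : ∀ c ∈ LinearMap.ker τ.flip, ∀ d ∈ LinearMap.ker τ.flip, τ (β c d) = 0 :=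
    fun c hc d hd => LinearMap.ext fun z =>
      DFunLike.congr_fun (hC _ ((hker_flip c).mp hc) _ ((hker_flip d).mp hd)) z.toMul
  have hβ_ne : LinearMap.ker (β (.ofMul a)) ≠ LinearMap.ker τ.flip := fun h =>
    hne (SetLike.ext fun x => (SetLike.ext_iff.mp h (.ofMul x)).trans (hker_flip _))
  have hdis := disjoint_ker_ker_flip hβ hβ_surj hτ hβ_flip (a := .ofMul a) ha hU hβ_ne
  refine ⟨Subgroup.disjoint_def.mpr fun {u} hu hu' => ?_, fun w hw => ?_⟩
  · exact Submodule.disjoint_def.mp hdis (.ofMul u) hu ((hker_flip _).mpr hu')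
  · exact eq_zero_of_forall_mem_ker hβ hβ_surj hτ hβ_flip (a := .ofMul a) ha hdis (w := .ofMul w) hw

end Bimultiplicative

section CommutatorPairing

open scoped IsMulCommutative

variable {G X M : Type*} [Group G] [Group X] [CommGroup M]

/-- The pairing `(x, g) ↦ ε ⁅κ x, g⁆`, bimultiplicative as soon as `ε` does not see conjugation
by `G`. Both commutator pairings of a group of class three are of this kind. -/
def commutatorPairing (κ : X →* G) {D : Subgroup G} [D.Normal] (hκ : ∀ x g, ⁅κ x, g⁆ ∈ D)
    (ε : D →* M) (hε : ∀ (g : G) (d : D), ε (MulAut.conjNormal g d) = ε d) :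
    X →* Abelianization G →* M :=
  MonoidHom.mk' (fun x => Abelianization.lift <| MonoidHom.mk' (fun g => ε ⟨⁅κ x, g⁆, hκ x g⟩)
    fun g h => by
      rw [← hε g ⟨⁅κ x, h⁆, hκ x h⟩, ← map_mul]
      congr 1
      ext
      simp only [commutatorElement_mul_right_eq_mul_conj, Subgroup.coe_mul,
        MulAut.conjNormal_apply, mul_assoc])
    fun x y => by
      ext g
      change ε _ = ε _ * ε _
      rw [← hε (κ x) ⟨⁅κ y, g⁆, hκ y g⟩, mul_comm, ← map_mul]
      congr 1
      ext
      simp only [map_mul, commutatorElement_mul_left_eq_conj_mul, Subgroup.coe_mul,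
        MulAut.conjNormal_apply]

theorem commutatorElement_mem_commutator (x y : G) : ⁅x, y⁆ ∈ commutator G :=
  Subgroup.commutator_mem_commutator (Subgroup.mem_top x) (Subgroup.mem_top y)

theorem commutatorElement_mem_third {w : G} (hw : w ∈ commutator G) (x : G) : ⁅w, x⁆ ∈ third G :=
  Subgroup.commutator_mem_commutator hw (Subgroup.mem_top x)

theorem third_le_commutator : third G ≤ commutator G :=
  Subgroup.commutator_le_left _ _

theorem commutator_le_centA (a : G) : commutator G ≤ centA a := fun w hw =>
  (mem_centA_iff a w).mpr <|
    commutatorElement_inv w a ▸ (third G).inv_mem (commutatorElement_mem_third hw a)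

theorem mem_centC_iff {N : Subgroup G} [N.Normal] {x : G} :
    x ∈ centC N ↔ ∀ w ∈ commutator G, ⁅w, x⁆ ∈ N := by
  simp only [centC, Subgroup.mem_comap, Subgroup.mem_centralizer_iff, Subgroup.coe_map,
    Set.forall_mem_image, SetLike.mem_coe]
  refine forall₂_congr fun w _ => ?_
  rw [← commutatorElement_eq_one_iff_mul_comm, ← map_commutatorElement]
  exact QuotientGroup.eq_one_iff _

variable (G) in
/-- The second lower central factor `G'/G₃`. -/
abbrev SecondFactor : Type _ :=
  commutator G ⧸ (third G).subgroupOf (commutator G)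

instance : IsMulCommutative (SecondFactor G) := by
  refine Subgroup.Normal.quotient_commutative_iff_commutator_le.mpr ?_
  rw [Subgroup.subgroupOf, ← Subgroup.map_le_iff_le_comap, Subgroup.map_subtype_commutator]
  exact Subgroup.commutator_mono le_rfl le_top

variable (G) in
/-- The pairing `G/G' × G/G' → G'/G₃` induced by commutators. -/
def commutatorForm : Abelianization G →* Abelianization G →* SecondFactor G :=
  Abelianization.lift <| commutatorPairing (.id G) commutatorElement_mem_commutator
    (QuotientGroup.mk' _) fun g w => Eq.symm <| QuotientGroup.eq.mpr <|
      Subgroup.mem_subgroupOf.mpr <| by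
        convert commutatorElement_mem_third ((commutator G).inv_mem w.2) g using 1
        simp only [Subgroup.coe_mul, Subgroup.coe_inv, MulAut.conjNormal_apply,
          commutatorElement_def, inv_inv, mul_assoc]

theorem commutatorForm_of_of_eq_one_iff {x y : G} :
    commutatorForm G (.of x) (.of y) = 1 ↔ y ∈ centA x := by
  rw [mem_centA_iff]
  exact (QuotientGroup.eq_one_iff _).trans Subgroup.mem_subgroupOf

theorem commutatorForm_self (v : Abelianization G) : commutatorForm G v v = 1 := by
  obtain ⟨x, rfl⟩ := QuotientGroup.mk_surjective v
  exact commutatorForm_of_of_eq_one_iff.mpr <|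
    (mem_centA_iff x x).mpr (commutatorElement_self x ▸ one_mem _)

/-- The pairing `G'/G₃ × G/G' → M` induced by commutators and a homomorphism `G₃ → M`, for `G₃`
central. -/
def thirdForm (hz : third G ≤ Subgroup.center G) (ε : third G →* M) :
    SecondFactor G →* Abelianization G →* M :=
  QuotientGroup.lift _ (commutatorPairing (commutator G).subtype
    (fun w => commutatorElement_mem_third w.2) ε fun g d => congrArg ε <| Subtype.ext <| by
      rw [MulAut.conjNormal_apply, Subgroup.mem_center_iff.mp (hz d.2) g, mul_inv_cancel_right])
    fun w hw => by
      ext x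
      change ε _ = 1
      convert map_one ε
      have hwx := Subgroup.mem_center_iff.mp (hz (Subgroup.mem_subgroupOf.mp hw)) x
      exact commutatorElement_eq_one_iff_mul_comm.mpr hwx.symm

theorem commutatorElement_commutatorElement_mem_of_mem_centC {N : Subgroup G} [N.Normal] {c d : G}
    (hc : c ∈ centC N) (hd : d ∈ centC N) (z : G) : ⁅⁅c, d⁆, z⁆ ∈ N := by
  have hmap : (commutator G).map (QuotientGroup.mk' N) = commutator (G ⧸ N) := by
    rw [commutator_def, commutator_def, Subgroup.map_commutator, ← MonoidHom.range_eq_map,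
      QuotientGroup.range_mk']
  rw [centC, Subgroup.mem_comap, hmap] at hc hd
  have hcd := commutator_centralizer_commutator_le_center _
    (Subgroup.commutator_mem_commutator hc hd)
  rw [← QuotientGroup.eq_one_iff, ← QuotientGroup.mk'_apply, map_commutatorElement,
    map_commutatorElement, commutatorElement_eq_one_iff_mul_comm]
  exact (Subgroup.mem_center_iff.mp hcd _).symm

theorem exists_monoidHom_ker_eq {p : ℕ} [Fact p.Prime] {N : Subgroup G} [N.Normal]
    (hN : N.index = p) : ∃ ε : G →* Multiplicative (ZMod p), ε.ker = N := by
  let e : G ⧸ N ≃* Multiplicative (ZMod p) := mulEquivOfPrimeCardEq (p := p) hN (Nat.card_zmod p)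
  refine ⟨(e : G ⧸ N →* _).comp (QuotientGroup.mk' N), ?_⟩
  rw [MonoidHom.ker_mulEquiv_comp, QuotientGroup.ker_mk']

section ThirdForm

variable (hz : third G ≤ Subgroup.center G) {ε : third G →* M} {N : Subgroup G}
  (hε : ε.ker = N.subgroupOf (third G))
include hε

theorem thirdForm_mk_of_eq_one_iff {w : commutator G} {x : G} :
    thirdForm hz ε (QuotientGroup.mk w) (.of x) = 1 ↔ ⁅(w : G), x⁆ ∈ N := by
  change ⟨⁅(w : G), x⁆, commutatorElement_mem_third w.2 x⟩ ∈ ε.ker ↔ _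
  rw [hε, Subgroup.mem_subgroupOf]

theorem of_mem_ker_flip_thirdForm_iff [N.Normal] {x : G} :
    Abelianization.of x ∈ (thirdForm hz ε).flip.ker ↔ x ∈ centC N := by
  rw [mem_centC_iff, MonoidHom.mem_ker, DFunLike.ext_iff]
  refine ⟨fun h w hw => ?_, fun h q => ?_⟩
  · exact (thirdForm_mk_of_eq_one_iff hz hε (w := ⟨w, hw⟩)).mp (h (QuotientGroup.mk ⟨w, hw⟩))
  · obtain ⟨w, rfl⟩ := QuotientGroup.mk_surjective q
    exact (thirdForm_mk_of_eq_one_iff hz hε).mpr (h w w.2)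

theorem thirdForm_ne_one (hN : ¬third G ≤ N) : thirdForm hz ε ≠ 1 := fun h =>
  hN <| Subgroup.commutator_le.mpr fun w hw x _ =>
    (thirdForm_mk_of_eq_one_iff hz hε (w := ⟨w, hw⟩)).mp (by rw [h]; rfl)

theorem thirdForm_commutatorForm_eq_one [N.Normal] {c d : Abelianization G}
    (hc : c ∈ (thirdForm hz ε).flip.ker) (hd : d ∈ (thirdForm hz ε).flip.ker) :
    thirdForm hz ε (commutatorForm G c d) = 1 := by
  obtain ⟨c, rfl⟩ := QuotientGroup.mk_surjective c
  obtain ⟨d, rfl⟩ := QuotientGroup.mk_surjective d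
  ext z
  exact (thirdForm_mk_of_eq_one_iff hz hε
    (w := ⟨⁅c, d⁆, commutatorElement_mem_commutator c d⟩)).mpr <|
    commutatorElement_commutatorElement_mem_of_mem_centC
      ((of_mem_ker_flip_thirdForm_iff hz hε).mp hc) ((of_mem_ker_flip_thirdForm_iff hz hε).mp hd) z

end ThirdForm

end CommutatorPairing

section Extraspecial

variable {p : ℕ} [Fact p.Prime]

theorem frattini_le_ker_of_prime_card {E M : Type*} [Group E] [Group M]
    [Fact (Nat.card M).Prime] (f : E →* M) : frattini E ≤ f.ker := by
  rcases Subgroup.eq_bot_or_eq_top_of_prime_card f.range with h | h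
  · rw [f.range_eq_bot_iff.mp h, MonoidHom.ker_one]
    exact le_top
  · have : Nontrivial M := not_subsingleton_iff_nontrivial.mp fun _ =>
      (Fact.out : (Nat.card M).Prime).ne_one Nat.card_unique
    have : IsCoatom (⊥ : Subgroup M) :=
      ⟨bot_ne_top, fun H hH => (Subgroup.eq_bot_or_eq_top_of_prime_card H).resolve_left hH.ne'⟩
    exact frattini_le_coatom <|
      Subgroup.isCoatom_comap_of_surjective (MonoidHom.range_eq_top.mp h) this

section

open scoped IsMulCommutative

theorem frattini_le_center {E : Type*} [Group E] [Fact (Nat.card (Subgroup.center E)).Prime]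
    (hE : commutator E ≤ Subgroup.center E) : frattini E ≤ Subgroup.center E := by
  have hmem (x y : E) : ⁅x, y⁆ ∈ Subgroup.center E := hE (commutatorElement_mem_commutator x y)
  let f := commutatorPairing (.id E) hmem (.id _) fun g d => Subtype.ext <| by
    change g * d * g⁻¹ = d
    rw [Subgroup.mem_center_iff.mp d.2 g, mul_inv_cancel_right]
  refine fun z hz => Subgroup.mem_center_iff.mpr fun x => ?_
  have hxz : f x (.of z) = 1 :=
    frattini_le_ker_of_prime_card ((f x).comp Abelianization.of) hz
  exact commutatorElement_eq_one_iff_mul_comm.mp (congrArg Subtype.val hxz)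

end

theorem center_le_frattini {E : Type*} [Group E] (hE : Subgroup.center E ≤ commutator E) :
    Subgroup.center E ≤ frattini E := by
  refine le_iInf₂ fun M hM => ?_
  by_contra hZM
  have hsup : M ⊔ Subgroup.center E = ⊤ := hM.2 _ (left_lt_sup.mpr hZM)
  have : M.Normal := Subgroup.normalizer_eq_top_iff.mp <| top_le_iff.mp <|
    hsup ▸ sup_le Subgroup.le_normalizer (Subgroup.center_le_normalizer _)
  exact hZM <| hE.trans <|
    Subgroup.Normal.commutator_le_of_self_sup_commutative_eq_top hsup inferInstance

theorem isExtraspecial_of_commutator_eq_center {E : Type*} [Group E] (hp : IsPGroup p E)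
    (hcard : Nat.card (Subgroup.center E) = p) (hE : commutator E = Subgroup.center E) :
    IsExtraspecial p E := by
  have : Fact (Nat.card (Subgroup.center E)).Prime := hcard ▸ inferInstance
  exact ⟨hp, hcard, hE, (frattini_le_center hE.le).antisymm (center_le_frattini hE.ge)⟩

variable {H : Type*} [Group H]

theorem mk_mem_center_iff {N : Subgroup H} [N.Normal] {x : H} :
    QuotientGroup.mk' N x ∈ Subgroup.center (H ⧸ N) ↔ ∀ y, ⁅x, y⁆ ∈ N := by
  rw [Subgroup.mem_center_iff, (QuotientGroup.mk'_surjective N).forall]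
  refine forall_congr' fun y => ?_
  rw [eq_comm, ← commutatorElement_eq_one_iff_mul_comm, ← map_commutatorElement]
  exact QuotientGroup.eq_one_iff _

theorem normal_of_le_center {N : Subgroup H} (hN : N ≤ Subgroup.center H) : N.Normal :=
  ⟨fun n hn g => by rwa [Subgroup.mem_center_iff.mp (hN hn) g, mul_inv_cancel_right]⟩

theorem commutator_le_of_isMulCommutative_map {N K : Subgroup H} [N.Normal]
    (hK : IsMulCommutative (K.map (QuotientGroup.mk' N))) : ⁅K, K⁆ ≤ N := by
  rw [← QuotientGroup.ker_mk' N, ← Subgroup.map_eq_bot_iff, Subgroup.map_commutator]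
  exact Subgroup.commutator_self_eq_bot_iff.mpr hK

theorem exists_le_relIndex_eq_prime [Finite H] (hp : IsPGroup p H) {K : Subgroup H}
    (hK : K ≠ ⊥) : ∃ N ≤ K, N.relIndex K = p := by
  have hpp : p.Prime := Fact.out
  obtain ⟨n, hn, hcard⟩ := (hp.to_subgroup K).nontrivial_iff_card.mp
    ((Subgroup.nontrivial_iff_ne_bot K).mpr hK)
  obtain ⟨m, rfl⟩ := Nat.exists_eq_succ_of_ne_zero hn.ne'
  obtain ⟨N, hNK, hN⟩ := Sylow.exists_subgroup_le_card_pow_prime_of_le_card (n := m) hpp hp (H := K)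
    (hcard ▸ Nat.pow_le_pow_right hpp.pos (Nat.le_succ m))
  refine ⟨N, hNK, Nat.eq_of_mul_eq_mul_left (pow_pos hpp.pos m) ?_⟩
  have hmul := Subgroup.relIndex_mul_relIndex ⊥ N K bot_le hNK
  rwa [Subgroup.relIndex_bot_left, Subgroup.relIndex_bot_left, hN, hcard, pow_succ] at hmul

section CentralQuotient

variable {Z : Subgroup H} (hcomm : commutator H ≤ Z) (hcenter : Z ≤ Subgroup.center H)
  (htop : Z ≠ ⊤)
include hcomm hcenter htop

theorem isExtraspecial_quotient (hp : IsPGroup p H) {N : Subgroup H} [N.Normal]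
    (hNZ : N.relIndex Z = p) (hnondeg : ∀ x, (∀ y, ⁅x, y⁆ ∈ N) → x ∈ Z) :
    IsExtraspecial p (H ⧸ N) := by
  have hmk (x : H) : QuotientGroup.mk' N x ∈ Subgroup.center (H ⧸ N) ↔ x ∈ Z := by
    refine mk_mem_center_iff.trans ⟨hnondeg x, fun hx y => ?_⟩
    rw [commutatorElement_eq_one_iff_mul_comm.mpr (Subgroup.mem_center_iff.mp (hcenter hx) y).symm]
    exact one_mem N
  have hcenterE : Subgroup.center (H ⧸ N) = Z.map (QuotientGroup.mk' N) := by
    rw [← Subgroup.map_comap_eq_self_of_surjective (QuotientGroup.mk'_surjective N)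
      (Subgroup.center _)]
    exact congrArg _ (Subgroup.ext hmk)
  have hcard : Nat.card (Subgroup.center (H ⧸ N)) = p := by
    rw [hcenterE, ← Subgroup.relIndex_ker, QuotientGroup.ker_mk', hNZ]
  refine isExtraspecial_of_commutator_eq_center (hp.to_quotient N) hcard ?_
  have hle : commutator (H ⧸ N) ≤ Subgroup.center (H ⧸ N) := by
    rw [hcenterE, commutator_def, ← QuotientGroup.range_mk' N, MonoidHom.range_eq_map,
      ← Subgroup.map_commutator]
    exact Subgroup.map_mono hcomm
  have hne : commutator (H ⧸ N) ≠ ⊥ := fun h => htop <| Subgroup.eq_top_iff' Z |>.mpr fun x =>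
    (hmk x).mp <| (commutator_eq_bot_iff_center_eq_top _).mp h ▸ Subgroup.mem_top _
  have : Fact (Nat.card (Subgroup.center (H ⧸ N))).Prime := hcard ▸ inferInstance
  refine hle.antisymm <| Subgroup.subgroupOf_eq_top.mp <|
    (Subgroup.eq_bot_or_eq_top_of_prime_card _).resolve_left fun h => hne ?_
  exact (Subgroup.subgroupOf_eq_bot.mp h).eq_bot_of_le hle

theorem isSemiExtraspecial_of_nondegenerate [Finite H] (hp : IsPGroup p H) (hbot : Z ≠ ⊥)
    (hnondeg : ∀ N ≤ Z, N.relIndex Z = p → ∀ x, (∀ y, ⁅x, y⁆ ∈ N) → x ∈ Z) :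
    IsSemiExtraspecial p H := by
  have hZ : Subgroup.center H = Z := by
    refine le_antisymm (fun x hx => ?_) hcenter
    obtain ⟨N, hN, hNZ⟩ := exists_le_relIndex_eq_prime hp hbot
    refine hnondeg N hN hNZ x fun y => ?_
    rw [commutatorElement_eq_one_iff_mul_comm.mpr (Subgroup.mem_center_iff.mp hx y).symm]
    exact one_mem N
  refine ⟨hp, Z.ne_bot_iff_exists_ne_one.mp hbot |>.elim fun x hx => ⟨x, 1, by simpa using hx⟩,
    fun N _ hN hNZ => ?_⟩
  rw [hZ] at hN hNZ
  exact isExtraspecial_quotient hcomm hcenter htop hp hNZ (hnondeg N hN hNZ)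

end CentralQuotient

theorem isSemiExtraspecial_subgroup {A K : Subgroup H} [Finite A] (hp : IsPGroup p A)
    (hKA : K ≤ A) (hcomm : ⁅A, A⁆ ≤ K) (hcenter : K ≤ Subgroup.center H) (hbot : K ≠ ⊥)
    (htop : ¬A ≤ K) (hnondeg : ∀ N ≤ K, N.relIndex K = p →
      ∀ x ∈ A, (∀ y ∈ A, ⁅x, y⁆ ∈ N) → x ∈ K) : IsSemiExtraspecial p A := by
  have hmap : (K.subgroupOf A).map A.subtype = K := by
    rw [Subgroup.subgroupOf_map_subtype, inf_eq_left.mpr hKA]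
  refine isSemiExtraspecial_of_nondegenerate (Z := K.subgroupOf A) ?_
    (fun x hx => Subgroup.mem_center_iff.mpr fun y =>
      Subtype.ext (Subgroup.mem_center_iff.mp (hcenter hx) y))
    (fun h => htop (Subgroup.subgroupOf_eq_top.mp h)) hp
    (fun h => hbot (by rw [← hmap, h, Subgroup.map_bot])) fun N hN hNK x hx => ?_
  · rwa [Subgroup.subgroupOf, ← Subgroup.map_le_iff_le_comap, Subgroup.map_subtype_commutator]
  · refine hnondeg (N.map A.subtype) (hmap ▸ Subgroup.map_mono hN) ?_ x x.2
      fun y hy => Subgroup.mem_map_of_mem A.subtype (hx ⟨y, hy⟩)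
    rw [← hNK, ← Subgroup.relIndex_map_map_of_injective N _ A.subtype_injective, hmap]

end Extraspecial

section Camina

open scoped IsMulCommutative

variable {G : Type*} [Group G]

section NilpotencyClass

variable [Group.IsNilpotent G] (hclass : Group.nilpotencyClass G = 3)
include hclass

theorem third_le_center : third G ≤ Subgroup.center G := by
  have h : (⊤ : Subgroup G).lowerCentralSeries 3 = ⊥ :=
    hclass ▸ Subgroup.lowerCentralSeries_nilpotencyClass
  rw [Subgroup.lowerCentralSeries_succ, Subgroup.lowerCentralSeries_succ,
    Subgroup.top_lowerCentralSeries_one] at h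
  exact Subgroup.commutator_top_right_eq_bot_iff_le_center.mp h

theorem third_ne_bot : third G ≠ ⊥ := by
  rw [third, ← Subgroup.top_lowerCentralSeries_one, ← Subgroup.lowerCentralSeries_succ, Ne,
    Subgroup.lowerCentralSeries_eq_bot_iff_nilpotencyClass_le, hclass]
  decide

theorem third_ne_commutator : third G ≠ commutator G := fun h =>
  third_ne_bot hclass <|
    Subgroup.commutator_top_right_eq_bot_iff_le_center.mpr (h ▸ third_le_center hclass)

end NilpotencyClass

theorem IsCamina.exists_commutatorElement_eq (hcam : IsCamina G) {a : G} (ha : a ∉ commutator G)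
    {w : G} (hw : w ∈ commutator G) : ∃ y, ⁅a, y⁆ = w := by
  have hmem : a⁻¹ * w⁻¹ * a ∈ commutator G := by
    simpa only [inv_inv] using
      (inferInstance : (commutator G).Normal).conj_mem _ ((commutator G).inv_mem hw) a⁻¹
  have hconj : a * (a⁻¹ * w⁻¹ * a) ∈ conjugatesOf a := by
    rw [hcam a ha]
    exact Set.smul_mem_smul_set hmem
  obtain ⟨c, hc⟩ := isConj_iff.mp hconj
  refine ⟨c, ?_⟩
  rw [← commutatorElement_inv, inv_eq_iff_eq_inv, commutatorElement_def, hc]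
  group

theorem IsCamina.commutatorForm_surjective (hcam : IsCamina G) {v : Abelianization G}
    (hv : v ≠ 1) : Function.Surjective (commutatorForm G v) := by
  intro q
  obtain ⟨a, rfl⟩ := QuotientGroup.mk_surjective v
  obtain ⟨w, rfl⟩ := QuotientGroup.mk_surjective q
  obtain ⟨y, hy⟩ := hcam.exists_commutatorElement_eq
    (fun h => hv ((QuotientGroup.eq_one_iff a).mpr h)) w.2
  exact ⟨.of y, congrArg QuotientGroup.mk (Subtype.ext hy)⟩

theorem IsCamina.secondFactor_pow_eq_one (hcam : IsCamina G) {n : ℕ}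
    (hpow : ∀ v : Abelianization G, v ^ n = 1) {v : Abelianization G} (hv : v ≠ 1)
    (q : SecondFactor G) : q ^ n = 1 := by
  obtain ⟨y, rfl⟩ := hcam.commutatorForm_surjective hv q
  rw [← map_pow, hpow, map_one]

variable {p : ℕ}

theorem subsingleton_of_pow_surjective {P : Type*} [Group P] [Finite P] (hP : IsPGroup p P)
    (hsurj : Function.Surjective fun x : P => x ^ p) : Subsingleton P := by
  have hinj := Finite.injective_iff_surjective.mpr hsurj
  refine subsingleton_of_forall_eq 1 fun x => ?_
  obtain ⟨k, hk⟩ := hP x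
  have hiter : (fun x : P => x ^ p)^[k] x = (fun x : P => x ^ p)^[k] 1 := by
    simp only [pow_iterate, hk, one_pow]
  exact hinj.iterate k hiter

variable [Finite G]

theorem IsCamina.abelianization_pow_eq_one (hcam : IsCamina G) (hp : IsPGroup p G)
    (hne : third G ≠ commutator G) (v : Abelianization G) : v ^ p = 1 := by
  by_contra hv
  have hsurj : Function.Surjective fun q : SecondFactor G => q ^ p := fun q => by
    obtain ⟨y, rfl⟩ := hcam.commutatorForm_surjective hv q
    exact ⟨commutatorForm G v y, by rw [map_pow, MonoidHom.pow_apply]⟩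
  have := subsingleton_of_pow_surjective ((hp.to_subgroup _).to_quotient _) hsurj
  exact hne <| third_le_commutator.antisymm <| Subgroup.subgroupOf_eq_top.mp <|
    QuotientGroup.subgroup_eq_top_of_subsingleton _ this

theorem IsCamina.mem_third_of_forall_commutatorElement_mem [Fact p.Prime] (hcam : IsCamina G)
    (hp : IsPGroup p G) (hz : third G ≤ Subgroup.center G) (hne : third G ≠ commutator G)
    {N : Subgroup G} [N.Normal] (hN : N.relIndex (third G) = p) {a : G} (ha : a ∉ commutator G)
    (hA : ⁅centA a, centA a⁆ ≤ third G) (hAC : centA a ≠ centC N) {x : G} (hx : x ∈ centA a)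
    (hxA : ∀ y ∈ centA a, ⁅x, y⁆ ∈ N) : x ∈ third G := by
  have hexp := hcam.abelianization_pow_eq_one hp hne
  have hv : Abelianization.of a ≠ 1 := fun h => ha ((QuotientGroup.eq_one_iff a).mp h)
  obtain ⟨ε, hε⟩ := exists_monoidHom_ker_eq (N := N.subgroupOf (third G)) hN
  have hthird : ¬third G ≤ N := fun h =>
    (Fact.out : p.Prime).ne_one (hN ▸ Subgroup.relIndex_eq_one.mpr h)
  have hU : ∀ y ∈ (commutatorForm G (.of a)).ker, ∀ z ∈ (commutatorForm G (.of a)).ker,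
      commutatorForm G y z = 1 := by
    intro y hy z hz
    obtain ⟨y, rfl⟩ := QuotientGroup.mk_surjective y
    obtain ⟨z, rfl⟩ := QuotientGroup.mk_surjective z
    exact commutatorForm_of_of_eq_one_iff.mpr <| (mem_centA_iff y z).mpr <|
      hA <| Subgroup.commutator_mem_commutator (commutatorForm_of_of_eq_one_iff.mp hy)
        (commutatorForm_of_of_eq_one_iff.mp hz)
  have hker : (commutatorForm G (.of a)).ker ≠ (thirdForm hz ε).flip.ker := fun h =>
    hAC <| Subgroup.ext fun y => commutatorForm_of_of_eq_one_iff.symm.trans <|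
      (SetLike.ext_iff.mp h _).trans (of_mem_ker_flip_thirdForm_iff hz hε)
  obtain ⟨hdisj, hinj⟩ := disjoint_ker_and_eq_one_of_bimultiplicative hexp
    (hcam.secondFactor_pow_eq_one hexp hv) commutatorForm_self
    (fun v => hcam.commutatorForm_surjective) (thirdForm_ne_one hz hε hthird)
    (fun c hc d hd => thirdForm_commutatorForm_eq_one hz hε hc hd) hv hU hker
  have hxC : x ∈ centC N := mem_centC_iff.mpr fun w hw =>
    commutatorElement_inv x w ▸ N.inv_mem (hxA w (commutator_le_centA a hw))
  have hxG : x ∈ commutator G := (QuotientGroup.eq_one_iff x).mp <|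
    Subgroup.disjoint_def.mp hdisj (commutatorForm_of_of_eq_one_iff.mpr hx)
      ((of_mem_ker_flip_thirdForm_iff hz hε).mpr hxC)
  refine Subgroup.mem_subgroupOf.mp <| (QuotientGroup.eq_one_iff (⟨x, hxG⟩ : commutator G)).mp <|
    hinj _ fun u hu => ?_
  obtain ⟨y, rfl⟩ := QuotientGroup.mk_surjective u
  exact (thirdForm_mk_of_eq_one_iff hz hε).mpr (hxA y (commutatorForm_of_of_eq_one_iff.mp hu))

end Camina

end CaminaGroup

open CaminaGroup in
theorem corollary5p3 {p : ℕ} [Fact p.Prime] {G : Type*} [Group G] [Finite G]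
    (hp : IsPGroup p G) (hcam : CaminaGroup.IsCamina G) (hclass : Group.nilpotencyClass G = 3)
    (A : Subgroup G) (hA : A ∈ CaminaGroup.setAStar G \ CaminaGroup.setC p G) :
    CaminaGroup.IsSemiExtraspecial p A := by
  have := hp.isNilpotent
  have hz := third_le_center hclass
  obtain ⟨⟨⟨a, ha, rfl⟩, hab⟩, hAC⟩ := hA
  have haA : a ∈ centA a := (mem_centA_iff a a).mpr (commutatorElement_self a ▸ one_mem _)
  have hcomm : ⁅centA a, centA a⁆ ≤ third G := commutator_le_of_isMulCommutative_map hab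
  refine isSemiExtraspecial_subgroup (hp.to_subgroup _)
    (third_le_commutator.trans (commutator_le_centA a)) hcomm hz (third_ne_bot hclass)
    (fun h => ha (third_le_commutator (h haA))) fun N hN hNp x hx hxA => ?_
  have := normal_of_le_center (hN.trans hz)
  exact hcam.mem_third_of_forall_commutatorElement_mem hp hz (third_ne_commutator hclass) hNp ha
    hcomm (fun h => hAC ⟨N, this, hN, hNp, h⟩) hx hxA
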